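/- Let $p\in\mathbb N$ and let $K\subset\mathbb R^p$ be a compact set that is the closure of its interior. Let $C^\infty(K)$ be the Fréchet space of all complex-valued functions $f\in C^\infty(\mathring K)$ that are uniformly continuous on $\mathring K$ together with all their partial derivatives (so $f$ and its partial derivatives extend continuously to $K$), with the topology defined by the norms $q_n(f)=\sup\{|f^{(\alpha)}(x)| : x\in K,\ |\alpha|\le n\}$, $n\in\mathbb N_0$. Let $C^\infty(\mathbb R^p)$ be the space of complex-valued smooth functions on $\mathbb R^p$ with its usual Fréchet topology (uniform convergence of all derivatives on compact sets), and let $C^\infty(K)'$ be the space of continuous linear functionals on $C^\infty(K)$. The following conditions are equivalent: (1) There is a continuous linear extension operator, i.e. a continuous linear map $T: C^\infty(K)\to C^\infty(\mathbb R^p)$ with $T(f)|_K=f$ for all $f\in C^\infty(K)$. (2) There are sequences $(\lambda_j)_{j}$ in $\mathbb R^p$ and $(u_j)_{j}$ in $C^\infty(K)'$ such that $\left(\{u_j\},\{e^{2\pi i x\cdot\lambda_j}\}\right)$ is an unconditional atomic decomposition of $C^\infty(K)$; that is, for every $f\in C^\infty(K)$ the series $\sum_{j=1}^\infty u_j(f)\,e^{2\pi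 i x\cdot\lambda_j}$ converges unconditionally to $f$ in $C^\infty(K)$. -/

import Mathlib

open Set Filter Topology TopologicalSpace
open scoped ContDiff

/-- `sup { ‖D^k f(x)‖ : x ∈ s, k ≤ n }`, where `D^k f(x)` is the `k`-th total derivative
(all partial derivatives of order `k` at once). -/
noncomputable def supDeriv {p : ℕ} (s : Set (EuclideanSpace ℝ (Fin p))) (n : ℕ)
    (f : EuclideanSpace ℝ (Fin p) → ℂ) : ℝ :=
  ⨆ i : Fin (n + 1) × s, ‖iteratedFDeriv ℝ (i.1 : ℕ) f (i.2 : EuclideanSpace ℝ (Fin p))‖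

theorem supDeriv_nonneg {p : ℕ} (s : Set (EuclideanSpace ℝ (Fin p))) (n : ℕ)
    (f : EuclideanSpace ℝ (Fin p) → ℂ) : 0 ≤ supDeriv s n f :=
  Real.iSup_nonneg fun _ => norm_nonneg _

theorem supDeriv_add_le {p : ℕ} {s : Set (EuclideanSpace ℝ (Fin p))} {n : ℕ}
    {f g : EuclideanSpace ℝ (Fin p) → ℂ}
    (hf : ∀ x ∈ s, ContDiffAt ℝ ∞ f x) (hg : ∀ x ∈ s, ContDiffAt ℝ ∞ g x)
    (bf : BddAbove (range fun i : Fin (n + 1) × s =>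
      ‖iteratedFDeriv ℝ (i.1 : ℕ) f (i.2 : EuclideanSpace ℝ (Fin p))‖))
    (bg : BddAbove (range fun i : Fin (n + 1) × s =>
      ‖iteratedFDeriv ℝ (i.1 : ℕ) g (i.2 : EuclideanSpace ℝ (Fin p))‖)) :
    supDeriv s n (f + g) ≤ supDeriv s n f + supDeriv s n g := by
  refine Real.iSup_le (fun i => ?_) (add_nonneg (supDeriv_nonneg _ _ _) (supDeriv_nonneg _ _ _))
  rw [iteratedFDeriv_add_apply ((hf _ i.2.2).of_le (by exact_mod_cast le_top))
    ((hg _ i.2.2).of_le (by exact_mod_cast le_top))]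
  exact (norm_add_le _ _).trans (add_le_add (le_ciSup bf i) (le_ciSup bg i))

theorem supDeriv_smul {p : ℕ} {s : Set (EuclideanSpace ℝ (Fin p))} {n : ℕ} (c : ℂ)
    {f : EuclideanSpace ℝ (Fin p) → ℂ} (hf : ∀ x ∈ s, ContDiffAt ℝ ∞ f x) :
    supDeriv s n (c • f) = ‖c‖ * supDeriv s n f := by
  unfold supDeriv
  rw [Real.mul_iSup_of_nonneg (norm_nonneg c)]
  congr 1
  funext i
  rw [iteratedFDeriv_const_smul_apply ((hf _ i.2.2).of_le (by exact_mod_cast le_top)), norm_smul]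

theorem supDeriv_zero {p : ℕ} (s : Set (EuclideanSpace ℝ (Fin p))) (n : ℕ) :
    supDeriv s n (0 : EuclideanSpace ℝ (Fin p) → ℂ) = 0 := by
  have h := supDeriv_smul (s := s) (n := n) (0 : ℂ)
    (f := (0 : EuclideanSpace ℝ (Fin p) → ℂ)) (fun x _ => contDiffAt_const)
  simpa using h

/-! ### The Fréchet space `C^∞(ℝ^p)` -/

/-- The smooth functions `ℝ^p → ℂ` as a subspace of all functions. -/
def smoothSubmodule (p : ℕ) : Submodule ℂ (EuclideanSpace ℝ (Fin p) → ℂ) where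
  carrier := {f | ContDiff ℝ ∞ f}
  add_mem' := by
    intro f g (hf : ContDiff ℝ ∞ f) (hg : ContDiff ℝ ∞ g)
    exact hf.add hg
  zero_mem' := (contDiff_const : ContDiff ℝ ∞ fun _ : EuclideanSpace ℝ (Fin p) => (0 : ℂ))
  smul_mem' := by
    intro c f (hf : ContDiff ℝ ∞ f)
    exact hf.const_smul c

/-- `C^∞(ℝ^p)`: the space of complex-valued smooth functions on `ℝ^p`. (A type of its own, so that
it does not carry the topology of pointwise convergence.) -/
def SmoothSpace (p : ℕ) : Type := smoothSubmodule p

namespace SmoothSpace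

variable {p : ℕ}

noncomputable instance : AddCommGroup (SmoothSpace p) :=
  inferInstanceAs (AddCommGroup (smoothSubmodule p))

noncomputable instance : Module ℂ (SmoothSpace p) :=
  inferInstanceAs (Module ℂ (smoothSubmodule p))

instance : CoeFun (SmoothSpace p) (fun _ => EuclideanSpace ℝ (Fin p) → ℂ) := ⟨fun f => f.1⟩

theorem contDiff (f : SmoothSpace p) : ContDiff ℝ ∞ f := f.2

theorem bddAbove (f : SmoothSpace p) (L : Compacts (EuclideanSpace ℝ (Fin p))) (n : ℕ) :
    BddAbove (range fun i : Fin (n + 1) × (L : Set (EuclideanSpace ℝ (Fin p))) =>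
      ‖iteratedFDeriv ℝ (i.1 : ℕ) f (i.2 : EuclideanSpace ℝ (Fin p))‖) := by
  have h : ∀ k : Fin (n + 1), ∃ C, ∀ x ∈ (L : Set (EuclideanSpace ℝ (Fin p))),
      ‖iteratedFDeriv ℝ (k : ℕ) f x‖ ≤ C := fun k =>
    L.isCompact.exists_bound_of_continuousOn
      (f.contDiff.continuous_iteratedFDeriv (by exact_mod_cast le_top)).continuousOn
  choose C hC using h
  refine ⟨∑ k, |C k|, ?_⟩
  rintro _ ⟨⟨k, x⟩, rfl⟩
  exact ((hC k x x.2).trans (le_abs_self _)).trans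
    (Finset.single_le_sum (f := fun k => |C k|) (fun _ _ => abs_nonneg _) (Finset.mem_univ k))

/-- The seminorms `f ↦ sup { ‖D^k f(x)‖ : x ∈ L, k ≤ n }`, for `L` compact and `n ∈ ℕ`. -/
noncomputable def seminorms (p : ℕ) :
    SeminormFamily ℂ (SmoothSpace p) (Compacts (EuclideanSpace ℝ (Fin p)) × ℕ) :=
  fun i => Seminorm.of (fun f => supDeriv (i.1 : Set (EuclideanSpace ℝ (Fin p))) i.2 f)
    (fun f g => supDeriv_add_le (fun _ _ => f.contDiff.contDiffAt)
      (fun _ _ => g.contDiff.contDiffAt) (f.bddAbove i.1 i.2) (g.bddAbove i.1 i.2))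
    (fun c f => supDeriv_smul c fun _ _ => f.contDiff.contDiffAt)

/-- The usual Fréchet topology of `C^∞(ℝ^p)`: uniform convergence on compact sets of all
derivatives. -/
noncomputable instance : TopologicalSpace (SmoothSpace p) :=
  (seminorms p).moduleFilterBasis.topology

theorem withSeminorms (p : ℕ) : WithSeminorms (seminorms p) := ⟨rfl⟩

end SmoothSpace

/-! ### The Fréchet space `C^∞(K)` -/

/-- The functions on `K` which are smooth in the interior of `K`, uniformly continuous there
together with all derivatives. Since `K` will be the closure of its interior, such a function on the
interior has exactly one continuous extension to `K`; we take `f` with its values on `K`, and, in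
order to have functions on `K` only, with the value `0` outside `K`. -/
def smoothOnSubmodule {p : ℕ} (K : Compacts (EuclideanSpace ℝ (Fin p))) :
    Submodule ℂ (EuclideanSpace ℝ (Fin p) → ℂ) where
  carrier := {f | (∀ x ∉ K, f x = 0) ∧ ContinuousOn f K ∧
    ContDiffOn ℝ ∞ f (interior (K : Set (EuclideanSpace ℝ (Fin p)))) ∧
    ∀ k : ℕ, UniformContinuousOn (iteratedFDeriv ℝ k f)
      (interior (K : Set (EuclideanSpace ℝ (Fin p))))}
  add_mem' := by
    rintro f g ⟨f0, f1, f2, f3⟩ ⟨g0, g1, g2, g3⟩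
    refine ⟨fun x hx => by simp [f0 x hx, g0 x hx], f1.add g1, f2.add g2, fun k => ?_⟩
    have h : UniformContinuousOn (fun x => iteratedFDeriv ℝ k f x + iteratedFDeriv ℝ k g x)
        (interior (K : Set (EuclideanSpace ℝ (Fin p)))) :=
      uniformContinuousOn_iff_restrict.2 ((uniformContinuousOn_iff_restrict.1 (f3 k)).add
        (uniformContinuousOn_iff_restrict.1 (g3 k)))
    refine h.congr fun x hx => ?_
    have hU := isOpen_interior.mem_nhds hx
    exact (iteratedFDeriv_add_apply ((f2.contDiffAt hU).of_le (by exact_mod_cast le_top))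
      ((g2.contDiffAt hU).of_le (by exact_mod_cast le_top))).symm
  zero_mem' := by
    refine ⟨fun _ _ => rfl, continuousOn_const, contDiffOn_const, fun k => ?_⟩
    have h : iteratedFDeriv ℝ k (0 : EuclideanSpace ℝ (Fin p) → ℂ) = 0 :=
      iteratedFDeriv_fun_zero
    rw [h]
    exact uniformContinuous_const.uniformContinuousOn
  smul_mem' := by
    rintro c f ⟨f0, f1, f2, f3⟩
    refine ⟨fun x hx => by simp [f0 x hx], f1.const_smul c, f2.const_smul c, fun k => ?_⟩
    refine UniformContinuousOn.congr
      ((uniformContinuous_const_smul c).comp_uniformContinuousOn (f3 k)) fun x hx => ?_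
    exact (iteratedFDeriv_const_smul_apply ((f2.contDiffAt
      (isOpen_interior.mem_nhds hx)).of_le (by exact_mod_cast le_top))).symm

/-- `C^∞(K)`. -/
def SmoothSpaceOn {p : ℕ} (K : Compacts (EuclideanSpace ℝ (Fin p))) : Type :=
  smoothOnSubmodule K

namespace SmoothSpaceOn

variable {p : ℕ} {K : Compacts (EuclideanSpace ℝ (Fin p))}

noncomputable instance : AddCommGroup (SmoothSpaceOn K) :=
  inferInstanceAs (AddCommGroup (smoothOnSubmodule K))

noncomputable instance : Module ℂ (SmoothSpaceOn K) :=
  inferInstanceAs (Module ℂ (smoothOnSubmodule K))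

instance : CoeFun (SmoothSpaceOn K) (fun _ => EuclideanSpace ℝ (Fin p) → ℂ) := ⟨fun f => f.1⟩

theorem contDiffAt (f : SmoothSpaceOn K) (x : EuclideanSpace ℝ (Fin p))
    (hx : x ∈ interior (K : Set (EuclideanSpace ℝ (Fin p)))) : ContDiffAt ℝ ∞ f x :=
  f.2.2.2.1.contDiffAt (isOpen_interior.mem_nhds hx)

theorem bddAbove (f : SmoothSpaceOn K) (n : ℕ) :
    BddAbove (range fun i : Fin (n + 1) × interior (K : Set (EuclideanSpace ℝ (Fin p))) =>
      ‖iteratedFDeriv ℝ (i.1 : ℕ) f (i.2 : EuclideanSpace ℝ (Fin p))‖) := by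
  have h : ∀ k : Fin (n + 1), ∃ C, ∀ x ∈ interior (K : Set (EuclideanSpace ℝ (Fin p))),
      ‖iteratedFDeriv ℝ (k : ℕ) f x‖ ≤ C := by
    intro k
    have hu : UniformContinuous fun x : interior (K : Set (EuclideanSpace ℝ (Fin p))) =>
        iteratedFDeriv ℝ (k : ℕ) f x := uniformContinuousOn_iff_restrict.1 (f.2.2.2.2 k)
    have ht : TotallyBounded (univ : Set (interior (K : Set (EuclideanSpace ℝ (Fin p))))) := by
      have := (K.isCompact.totallyBounded.subset interior_subset)
      exact totallyBounded_preimage (s := interior (K : Set (EuclideanSpace ℝ (Fin p))))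
        isUniformEmbedding_subtype_val.isUniformInducing this |>.subset fun x _ => x.2
    obtain ⟨C, hC⟩ := (ht.image hu).isBounded.exists_norm_le
    exact ⟨C, fun x hx => hC _ ⟨⟨x, hx⟩, mem_univ _, rfl⟩⟩
  choose C hC using h
  refine ⟨∑ k, |C k|, ?_⟩
  rintro _ ⟨⟨k, x⟩, rfl⟩
  exact ((hC k x x.2).trans (le_abs_self _)).trans
    (Finset.single_le_sum (f := fun k => |C k|) (fun _ _ => abs_nonneg _) (Finset.mem_univ k))

/-- The norms `q_n(f) = sup { ‖D^k f(x)‖ : x ∈ K, k ≤ n }`. The derivatives at boundary points are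
the continuous extensions from the interior, so that, the interior being dense in `K`, the supremum
over `K` is the supremum over the interior. -/
noncomputable def seminorms (K : Compacts (EuclideanSpace ℝ (Fin p))) :
    SeminormFamily ℂ (SmoothSpaceOn K) ℕ :=
  fun n => Seminorm.of
    (fun f => supDeriv (interior (K : Set (EuclideanSpace ℝ (Fin p)))) n f)
    (fun f g => supDeriv_add_le f.contDiffAt g.contDiffAt (f.bddAbove n) (g.bddAbove n))
    (fun c f => supDeriv_smul c f.contDiffAt)

/-- The Fréchet topology of `C^∞(K)`, defined by the norms `q_n`. -/
noncomputable instance : TopologicalSpace (SmoothSpaceOn K) :=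
  (seminorms K).moduleFilterBasis.topology

theorem withSeminorms (K : Compacts (EuclideanSpace ℝ (Fin p))) :
    WithSeminorms (seminorms K) := ⟨rfl⟩

/-- The restriction to `K` of a smooth function on `ℝ^p`, as an element of `C^∞(K)`. -/
noncomputable def restrict (K : Compacts (EuclideanSpace ℝ (Fin p))) (g : SmoothSpace p) :
    SmoothSpaceOn K :=
  ⟨(K : Set (EuclideanSpace ℝ (Fin p))).indicator g, by
    have he : ∀ x ∈ (K : Set (EuclideanSpace ℝ (Fin p))),
        (K : Set (EuclideanSpace ℝ (Fin p))).indicator g x = g x :=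
      fun x hx => indicator_of_mem hx _
    refine ⟨fun x hx => indicator_of_notMem hx _, g.contDiff.continuous.continuousOn.congr he,
      g.contDiff.contDiffOn.congr fun x hx => he x (interior_subset hx), fun k => ?_⟩
    have hu : UniformContinuousOn (iteratedFDeriv ℝ k g) K :=
      K.isCompact.uniformContinuousOn_of_continuous
        (g.contDiff.continuous_iteratedFDeriv (by exact_mod_cast le_top)).continuousOn
    refine (hu.mono interior_subset).congr fun x hx => ?_
    have : (K : Set (EuclideanSpace ℝ (Fin p))).indicator g =ᶠ[𝓝 x] g :=
      Filter.mem_of_superset (isOpen_interior.mem_nhds hx) fun y hy => he y (interior_subset hy)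
    exact (this.iteratedFDeriv ℝ k).eq_of_nhds.symm⟩

end SmoothSpaceOn

/-- The exponential `x ↦ e^{2πi x·l}` on `ℝ^p`. -/
noncomputable def smoothExp {p : ℕ} (l : EuclideanSpace ℝ (Fin p)) : SmoothSpace p :=
  ⟨fun x => Complex.exp (2 * Real.pi * Complex.I * ((inner ℝ x l : ℝ) : ℂ)), by
    have h : ContDiff ℝ ∞ fun x : EuclideanSpace ℝ (Fin p) => ((inner ℝ x l : ℝ) : ℂ) :=
      Complex.ofRealCLM.contDiff.comp (contDiff_id.inner ℝ contDiff_const)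
    exact (contDiff_const.mul h).cexp⟩

/-- `T` is an extension operator: `T f` restricted to `K` is `f`, for all `f ∈ C^∞(K)`. -/
def IsExtensionOperator {p : ℕ} {K : Compacts (EuclideanSpace ℝ (Fin p))}
    (T : SmoothSpaceOn K →L[ℂ] SmoothSpace p) : Prop :=
  ∀ f : SmoothSpaceOn K, ∀ x ∈ K, T f x = f x

/-! ### Atomic decompositions -/

/-- `({u j}, {x j})` is an atomic decomposition of `E`: every `y ∈ E` is the sum of the convergent
series `∑ u j (y) x j`. -/
def IsAtomicDecomposition {E : Type*} [AddCommGroup E] [Module ℂ E] [TopologicalSpace E]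
    (u : ℕ → E →L[ℂ] ℂ) (x : ℕ → E) : Prop :=
  ∀ y : E, Tendsto (fun n => ∑ j ∈ Finset.range n, u j y • x j) atTop (𝓝 y)

/-- An atomic decomposition is unconditional if all the series `∑ u j (y) x j` converge
unconditionally (`HasSum`: the net of all finite partial sums converges). -/
def IsUnconditionalAtomicDecomposition {E : Type*} [AddCommGroup E] [Module ℂ E]
    [TopologicalSpace E] (u : ℕ → E →L[ℂ] ℂ) (x : ℕ → E) : Prop :=
  IsAtomicDecomposition u x ∧ ∀ y : E, HasSum (fun j => u j y • x j) y

/-! ### Derivatives of the exponentials -/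

section Exponentials

variable {p : ℕ}

/-! From (2) to (1): the `k`-th derivative of `e^{2πi x·λ}` has norm `(2π|λ|)^k` at every point `x`.
Applying `D^k` at a single interior point of `K` to the expansion of `f` gives an unconditionally,
hence absolutely, convergent series in a finite-dimensional space, so `∑ |u_j(f)| |λ_j|^k < ∞` for
all `k` (`summable_of_summable_smoothExp`). The same series then converges in `C^∞(ℝ^p)`
(`exists_hasSum_smoothExp`), and its sum extends `f`. The sum depends continuously on `f` by
Banach-Steinhaus, since `C^∞(K)` is Fréchet and so barrelled (`barrelledSpace`).

From (1) to (2): rescale so that `K` lies in a small ball, and multiply the rescaled `T f` by a bump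
function that is `1` on this ball and supported well inside the unit cube. The product is the sum of
its Fourier series on the cube (`hasSum_fourier_intVec`), with coefficients the values of a Schwartz
function at the points of `ℤ^p`, which decrease rapidly. Scaling back gives a series of exponentials
that converges in `C^∞(ℝ^p)` and equals `f` on `K`; its coefficients are continuous in `f` because
`T` is. -/

theorem smoothExp_apply (l x : EuclideanSpace ℝ (Fin p)) :
    smoothExp l x = Complex.exp (2 * Real.pi * Complex.I * ((inner ℝ x l : ℝ) : ℂ)) := rfl

theorem norm_smoothExp_apply (l x : EuclideanSpace ℝ (Fin p)) : ‖smoothExp l x‖ = 1 := by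
  rw [smoothExp_apply, Complex.norm_exp]
  simp

theorem iteratedDeriv_cexp_ofReal_mul (c : ℂ) (k : ℕ) :
    iteratedDeriv k (fun t : ℝ => Complex.exp (c * t)) =
      fun t : ℝ => c ^ k * Complex.exp (c * t) := by
  induction k with
  | zero => simp
  | succ k ih =>
    rw [iteratedDeriv_succ, ih]
    funext t
    have h : HasDerivAt (fun t : ℝ => c * (t : ℂ)) c t := by
      simpa using (Complex.ofRealCLM.hasDerivAt (x := t)).const_mul c
    rw [(h.cexp.const_mul (c ^ k)).deriv]
    ring

theorem iteratedFDeriv_smoothExp_apply (l x : EuclideanSpace ℝ (Fin p)) (k : ℕ)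
    (m : Fin k → EuclideanSpace ℝ (Fin p)) :
    iteratedFDeriv ℝ k (smoothExp l) x m =
      (∏ i, inner ℝ (m i) l) • ((2 * Real.pi * Complex.I) ^ k * smoothExp l x) := by
  have hg : ContDiff ℝ ∞ (fun t : ℝ => Complex.exp (2 * Real.pi * Complex.I * t)) :=
    (contDiff_const.mul Complex.ofRealCLM.contDiff).cexp
  have he : (smoothExp l : EuclideanSpace ℝ (Fin p) → ℂ) =
      (fun t : ℝ => Complex.exp (2 * Real.pi * Complex.I * t)) ∘ innerSL ℝ l := by
    funext y
    simp [smoothExp_apply, real_inner_comm]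
  rw [he, ContinuousLinearMap.iteratedFDeriv_comp_right _ hg x
    (by exact_mod_cast le_top : (k : WithTop ℕ∞) ≤ ∞),
    ContinuousMultilinearMap.compContinuousLinearMap_apply,
    iteratedFDeriv_apply_eq_iteratedDeriv_mul_prod, iteratedDeriv_cexp_ofReal_mul]
  simp [real_inner_comm]

/-- The absence of `x` on the right is what lets one interior point control the derivatives on all
of `ℝ^p`. -/
theorem norm_iteratedFDeriv_smoothExp (l x : EuclideanSpace ℝ (Fin p)) (k : ℕ) :
    ‖iteratedFDeriv ℝ k (smoothExp l) x‖ = (2 * Real.pi) ^ k * ‖l‖ ^ k := by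
  have hn (m : Fin k → EuclideanSpace ℝ (Fin p)) :
      ‖iteratedFDeriv ℝ k (smoothExp l) x m‖ =
        (2 * Real.pi) ^ k * ∏ i, |inner ℝ (m i) l| := by
    rw [iteratedFDeriv_smoothExp_apply, norm_smul, norm_mul, norm_smoothExp_apply, norm_pow,
      norm_prod]
    simp [abs_of_pos Real.pi_pos, mul_comm]
  refine le_antisymm (ContinuousMultilinearMap.opNorm_le_bound (by positivity) fun m => ?_) ?_
  · rw [hn, mul_assoc]
    gcongr
    calc ∏ i, |inner ℝ (m i) l| ≤ ∏ i, (‖m i‖ * ‖l‖) :=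
          Finset.prod_le_prod (fun _ _ => abs_nonneg _) fun i _ => abs_real_inner_le_norm _ _
      _ = ‖l‖ ^ k * ∏ i, ‖m i‖ := by
          rw [Finset.prod_mul_distrib]
          simp [mul_comm]
  -- The lower bound comes from the tuple `(l, …, l)`, after division by `‖l‖ ^ k`; for `l = 0` the
  -- cases `k = 0` and `k > 0` differ because `0 ^ 0 = 1`.
  · rcases eq_or_ne l 0 with rfl | hl
    · rcases k with _ | k
      · simpa using (hn ![]).ge
      · simp
    · have h1 := (iteratedFDeriv ℝ k (smoothExp l) x).le_opNorm fun _ => l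
      rw [hn] at h1
      simp only [real_inner_self_eq_norm_sq, Finset.prod_const, Finset.card_univ,
        Fintype.card_fin, abs_pow, abs_norm] at h1
      have hp : 0 < ‖l‖ ^ k := pow_pos (norm_pos_iff.2 hl) k
      refine le_of_mul_le_mul_right (le_trans (le_of_eq ?_) h1) hp
      ring

end Exponentials

theorem supDeriv_le {p : ℕ} {s : Set (EuclideanSpace ℝ (Fin p))} {n : ℕ}
    {f : EuclideanSpace ℝ (Fin p) → ℂ} {C : ℝ} (hC : 0 ≤ C)
    (h : ∀ k ≤ n, ∀ x ∈ s, ‖iteratedFDeriv ℝ k f x‖ ≤ C) : supDeriv s n f ≤ C :=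
  Real.iSup_le (fun i => h _ (Nat.lt_succ_iff.1 i.1.2) _ i.2.2) hC

/-! ### Topology of `C^∞(ℝ^p)` and series of exponentials -/

namespace SmoothSpace

variable {p : ℕ}

instance : IsTopologicalAddGroup (SmoothSpace p) := (withSeminorms p).topologicalAddGroup

instance : ContinuousSMul ℂ (SmoothSpace p) := (withSeminorms p).continuousSMul

instance : PolynormableSpace ℂ (SmoothSpace p) := (withSeminorms p).toPolynormableSpace

theorem ext {f g : SmoothSpace p} (h : ∀ x, f x = g x) : f = g := Subtype.ext (funext h)

theorem norm_iteratedFDeriv_le (f : SmoothSpace p) (L : Compacts (EuclideanSpace ℝ (Fin p)))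
    {k n : ℕ} (hk : k ≤ n) {x : EuclideanSpace ℝ (Fin p)} (hx : x ∈ L) :
    ‖iteratedFDeriv ℝ k f x‖ ≤ seminorms p (L, n) f :=
  le_ciSup (f.bddAbove L n) (⟨k, Nat.lt_succ_of_le hk⟩, ⟨x, hx⟩)

theorem norm_apply_le (f : SmoothSpace p) (L : Compacts (EuclideanSpace ℝ (Fin p)))
    {x : EuclideanSpace ℝ (Fin p)} (hx : x ∈ L) : ‖f x‖ ≤ seminorms p (L, 0) f := by
  simpa using f.norm_iteratedFDeriv_le L (le_refl 0) hx

instance : T2Space (SmoothSpace p) := by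
  have : T1Space (SmoothSpace p) := (withSeminorms p).T1_of_separating fun f hf => by
    by_contra! h
    refine hf (ext fun x => ?_)
    have := f.norm_apply_le ⟨{x}, isCompact_singleton⟩ (mem_singleton x)
    rw [h] at this
    exact norm_le_zero_iff.1 this
  infer_instance

/-- Forgetting smoothness. -/
def coeLinearMap (p : ℕ) : SmoothSpace p →ₗ[ℂ] (EuclideanSpace ℝ (Fin p) → ℂ) :=
  (smoothSubmodule p).subtype

theorem coe_sum {ι : Type*} (s : Finset ι) (f : ι → SmoothSpace p) :
    (∑ j ∈ s, f j : SmoothSpace p).1 = fun x => ∑ j ∈ s, f j x := by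
  have := map_sum (coeLinearMap p) f s
  funext x
  exact (congrFun this x).trans (Finset.sum_apply _ _ _)

theorem iteratedFDeriv_smul (c : ℂ) (f : SmoothSpace p) (k : ℕ) (x : EuclideanSpace ℝ (Fin p)) :
    iteratedFDeriv ℝ k (c • f : SmoothSpace p) x = c • iteratedFDeriv ℝ k f x :=
  iteratedFDeriv_const_smul_apply (f.contDiff.contDiffAt.of_le (by exact_mod_cast le_top))

theorem iteratedFDeriv_sub (f g : SmoothSpace p) (k : ℕ) (x : EuclideanSpace ℝ (Fin p)) :
    iteratedFDeriv ℝ k (f - g : SmoothSpace p) x =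
      iteratedFDeriv ℝ k f x - iteratedFDeriv ℝ k g x :=
  iteratedFDeriv_sub_apply (f.contDiff.contDiffAt.of_le (by exact_mod_cast le_top))
    (g.contDiff.contDiffAt.of_le (by exact_mod_cast le_top))

theorem iteratedFDeriv_finsetSum {ι : Type*} (s : Finset ι) (f : ι → SmoothSpace p) (k : ℕ)
    (x : EuclideanSpace ℝ (Fin p)) :
    iteratedFDeriv ℝ k (∑ j ∈ s, f j : SmoothSpace p) x = ∑ j ∈ s, iteratedFDeriv ℝ k (f j) x := by
  rw [coe_sum]
  exact iteratedFDeriv_fun_sum_apply fun j _ =>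
    (f j).contDiff.contDiffAt.of_le (by exact_mod_cast le_top)

/-- Uniform convergence of all derivatives implies convergence in `C^∞(ℝ^p)`. -/
theorem tendsto_of_tendstoUniformly {ι : Type*} {l : Filter ι} {f : ι → SmoothSpace p}
    {g : SmoothSpace p}
    (h : ∀ k : ℕ, TendstoUniformly (fun i => iteratedFDeriv ℝ k (f i)) (iteratedFDeriv ℝ k g) l) :
    Tendsto f l (𝓝 g) := by
  refine ((withSeminorms p).tendsto_nhds _ _).2 ?_
  rintro ⟨L, n⟩ ε hε
  have h1 : ∀ᶠ i in l, ∀ k ∈ Finset.range (n + 1), ∀ x,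
      dist (iteratedFDeriv ℝ k g x) (iteratedFDeriv ℝ k (f i) x) < ε / 2 :=
    (Finset.eventually_all _).2 fun k _ => Metric.tendstoUniformly_iff.1 (h k) _ (half_pos hε)
  filter_upwards [h1] with i hi
  refine lt_of_le_of_lt (supDeriv_le (half_pos hε).le fun k hk x _ => ?_) (half_lt_self hε)
  rw [iteratedFDeriv_sub, ← dist_eq_norm, dist_comm]
  exact (hi k (Finset.mem_range.2 (Nat.lt_succ_of_le hk)) x).le

/-- A series of exponentials with rapidly decreasing coefficients converges in `C^∞(ℝ^p)`. -/
theorem exists_hasSum_smoothExp {ι : Type*} (c : ι → ℂ) (l : ι → EuclideanSpace ℝ (Fin p))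
    (h : ∀ k : ℕ, Summable fun j => ‖c j‖ * ‖l j‖ ^ k) :
    ∃ g : SmoothSpace p, (∀ x, g x = ∑' j, c j * smoothExp (l j) x) ∧
      HasSum (fun j => c j • smoothExp (l j)) g := by
  have hs (k : ℕ) : Summable fun j => (2 * Real.pi) ^ k * (‖c j‖ * ‖l j‖ ^ k) := (h k).mul_left _
  -- Majorants for the Weierstrass test, uniform on all of `ℝ^p`, for every order of
  -- differentiation.
  have hb (k : ℕ) (j : ι) (x : EuclideanSpace ℝ (Fin p)) :
      ‖iteratedFDeriv ℝ k (c j • smoothExp (l j) : SmoothSpace p) x‖ ≤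
        (2 * Real.pi) ^ k * (‖c j‖ * ‖l j‖ ^ k) := by
    rw [iteratedFDeriv_smul, norm_smul, norm_iteratedFDeriv_smoothExp]
    exact le_of_eq (by ring)
  have hd : ContDiff ℝ ∞ fun x => ∑' j, (c j • smoothExp (l j) : SmoothSpace p) x :=
    contDiff_tsum (N := ⊤) (fun j => (c j • smoothExp (l j)).contDiff) (fun k _ => hs k)
      (fun k j x _ => hb k j x)
  refine ⟨⟨_, hd⟩, fun x => rfl, tendsto_of_tendstoUniformly fun k => ?_⟩
  have he : iteratedFDeriv ℝ k (fun x => ∑' j, (c j • smoothExp (l j) : SmoothSpace p) x) =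
      fun x => ∑' j, iteratedFDeriv ℝ k (c j • smoothExp (l j) : SmoothSpace p) x :=
    iteratedFDeriv_tsum (N := ⊤) (fun j => (c j • smoothExp (l j)).contDiff) (fun k _ => hs k)
      (fun k j x _ => hb k j x) le_top
  have hu := tendstoUniformly_tsum (hs k) (hb k)
  change TendstoUniformly _ (iteratedFDeriv ℝ k fun x => ∑' j, _) _
  rw [he]
  have hsum : (fun s : Finset ι => iteratedFDeriv ℝ k
      (∑ j ∈ s, c j • smoothExp (l j) : SmoothSpace p)) = fun s x =>
      ∑ j ∈ s, iteratedFDeriv ℝ k (c j • smoothExp (l j) : SmoothSpace p) x :=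
    funext fun s => funext fun x => iteratedFDeriv_finsetSum _ _ _ _
  rw [hsum]
  exact hu

end SmoothSpace

/-! ### Continuous maps on `C^∞(K)`: evaluation, derivatives, restriction -/

namespace SmoothSpaceOn

variable {p : ℕ} {K : Compacts (EuclideanSpace ℝ (Fin p))}

instance : IsTopologicalAddGroup (SmoothSpaceOn K) := (withSeminorms K).topologicalAddGroup

instance : ContinuousSMul ℂ (SmoothSpaceOn K) := (withSeminorms K).continuousSMul

instance : FirstCountableTopology (SmoothSpaceOn K) := (withSeminorms K).firstCountableTopology

theorem ext {f g : SmoothSpaceOn K} (h : ∀ x ∈ K, f x = g x) : f = g := by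
  refine Subtype.ext (funext fun x => ?_)
  by_cases hx : x ∈ K
  · exact h x hx
  · exact (f.2.1 x hx).trans (g.2.1 x hx).symm

theorem norm_iteratedFDeriv_le (f : SmoothSpaceOn K) {k n : ℕ} (hk : k ≤ n)
    {x : EuclideanSpace ℝ (Fin p)} (hx : x ∈ interior (K : Set (EuclideanSpace ℝ (Fin p)))) :
    ‖iteratedFDeriv ℝ k f x‖ ≤ seminorms K n f :=
  le_ciSup (f.bddAbove n) (⟨k, Nat.lt_succ_of_le hk⟩, ⟨x, hx⟩)

/-- The seminorm only sees the interior; the bound passes to boundary points by density of the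
interior in `K` and continuity of `f` on `K`. -/
theorem norm_apply_le (hK : (K : Set (EuclideanSpace ℝ (Fin p))) =
    closure (interior (K : Set (EuclideanSpace ℝ (Fin p))))) (f : SmoothSpaceOn K)
    {x : EuclideanSpace ℝ (Fin p)} (hx : x ∈ K) : ‖f x‖ ≤ seminorms K 0 f := by
  have hx' : x ∈ closure (interior (K : Set (EuclideanSpace ℝ (Fin p)))) := hK ▸ hx
  have hc : ContinuousWithinAt f (interior (K : Set (EuclideanSpace ℝ (Fin p)))) x :=
    (f.2.2.1 x hx).mono interior_subset
  have := mem_closure_iff_nhdsWithin_neBot.1 hx'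
  refine le_of_tendsto hc.norm ?_
  filter_upwards [self_mem_nhdsWithin] with y hy
  simpa using f.norm_iteratedFDeriv_le (le_refl 0) hy

/-- Evaluation at a point of `K`. -/
noncomputable def evalCLM (hK : (K : Set (EuclideanSpace ℝ (Fin p))) =
    closure (interior (K : Set (EuclideanSpace ℝ (Fin p))))) {x : EuclideanSpace ℝ (Fin p)}
    (hx : x ∈ K) : SmoothSpaceOn K →L[ℂ] ℂ :=
  let A : SmoothSpaceOn K →ₗ[ℂ] ℂ :=
    { toFun := fun f => f x
      map_add' := fun _ _ => rfl
      map_smul' := fun _ _ => rfl }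
  ⟨A, (withSeminorms K).continuous_normedSpace_rng ℂ A ⟨{0}, 1, fun f => by
    simp only [one_smul, Finset.sup_singleton]
    exact norm_apply_le hK f hx⟩⟩

theorem evalCLM_apply (hK : (K : Set (EuclideanSpace ℝ (Fin p))) =
    closure (interior (K : Set (EuclideanSpace ℝ (Fin p))))) {x : EuclideanSpace ℝ (Fin p)}
    (hx : x ∈ K) (f : SmoothSpaceOn K) : evalCLM hK hx f = f x := rfl

/-- The iterated derivative at an interior point of `K`. -/
noncomputable def iteratedFDerivCLM (k : ℕ) {x : EuclideanSpace ℝ (Fin p)}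
    (hx : x ∈ interior (K : Set (EuclideanSpace ℝ (Fin p)))) :
    SmoothSpaceOn K →L[ℂ] (EuclideanSpace ℝ (Fin p) [×k]→L[ℝ] ℂ) :=
  let A : SmoothSpaceOn K →ₗ[ℂ] (EuclideanSpace ℝ (Fin p) [×k]→L[ℝ] ℂ) :=
    { toFun := fun f => iteratedFDeriv ℝ k f x
      map_add' := fun f g => iteratedFDeriv_add_apply
        ((f.contDiffAt x hx).of_le (by exact_mod_cast le_top))
        ((g.contDiffAt x hx).of_le (by exact_mod_cast le_top))
      map_smul' := fun c f => iteratedFDeriv_const_smul_apply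
        ((f.contDiffAt x hx).of_le (by exact_mod_cast le_top)) }
  ⟨A, (withSeminorms K).continuous_normedSpace_rng _ A ⟨{k}, 1, fun f => by
        simp only [one_smul, Finset.sup_singleton]
        exact norm_iteratedFDeriv_le f le_rfl hx⟩⟩

theorem iteratedFDerivCLM_apply (k : ℕ) {x : EuclideanSpace ℝ (Fin p)}
    (hx : x ∈ interior (K : Set (EuclideanSpace ℝ (Fin p)))) (f : SmoothSpaceOn K) :
    iteratedFDerivCLM k hx f = iteratedFDeriv ℝ k f x := rfl

theorem restrict_apply (g : SmoothSpace p) {x : EuclideanSpace ℝ (Fin p)} (hx : x ∈ K) :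
    restrict K g x = g x := indicator_of_mem hx _

theorem iteratedFDeriv_restrict (g : SmoothSpace p) (k : ℕ) {x : EuclideanSpace ℝ (Fin p)}
    (hx : x ∈ interior (K : Set (EuclideanSpace ℝ (Fin p)))) :
    iteratedFDeriv ℝ k (restrict K g) x = iteratedFDeriv ℝ k g x := by
  have : (restrict K g : EuclideanSpace ℝ (Fin p) → ℂ) =ᶠ[𝓝 x] g :=
    Filter.mem_of_superset (isOpen_interior.mem_nhds hx) fun y hy =>
      restrict_apply g (interior_subset hy)
  exact (this.iteratedFDeriv ℝ k).eq_of_nhds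

/-- The restriction `C^∞(ℝ^p) → C^∞(K)` as a continuous linear map. -/
noncomputable def restrictCLM (K : Compacts (EuclideanSpace ℝ (Fin p))) :
    SmoothSpace p →L[ℂ] SmoothSpaceOn K :=
  let A : SmoothSpace p →ₗ[ℂ] SmoothSpaceOn K :=
    { toFun := restrict K
      map_add' := fun f g => ext fun x hx => by
        change restrict K (f + g) x = restrict K f x + restrict K g x
        simp only [restrict_apply _ hx]
        rfl
      map_smul' := fun c f => ext fun x hx => by
        change restrict K (c • f) x = c * restrict K f x
        simp only [restrict_apply _ hx]
        rfl }
  ⟨A, (SmoothSpace.withSeminorms p).continuous_of_isBounded (withSeminorms K) A fun n =>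
    ⟨{(K, n)}, 1, fun f => by
      simp only [one_smul, Finset.sup_singleton]
      refine supDeriv_le (apply_nonneg _ _) fun k hk x hx => ?_
      exact (congrArg norm (iteratedFDeriv_restrict f k hx)).trans_le
        (f.norm_iteratedFDeriv_le K hk (interior_subset hx))⟩⟩

theorem restrictCLM_apply (g : SmoothSpace p) : restrictCLM K g = restrict K g := rfl

end SmoothSpaceOn

/-- If all derivatives of a sequence of smooth functions converge uniformly on an open set, then
the limits form a Taylor series of the limit function. -/
theorem hasFTaylorSeriesUpToOn_of_tendstoUniformlyOn {E F : Type*} [NormedAddCommGroup E]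
    [NormedSpace ℝ E] [NormedAddCommGroup F] [NormedSpace ℝ F] {U : Set E} (hU : IsOpen U)
    {f : ℕ → E → F} {f₀ : E → F} {g : E → FormalMultilinearSeries ℝ E F}
    (hf : ∀ i, ContDiffOn ℝ ∞ (f i) U)
    (hg : ∀ k, TendstoUniformlyOn (fun i => iteratedFDeriv ℝ k (f i)) (fun x => g x k) atTop U)
    (h₀ : ∀ x ∈ U, Tendsto (fun i => f i x) atTop (𝓝 (f₀ x))) :
    HasFTaylorSeriesUpToOn ∞ f₀ g U where
  zero_eq x hx := by
    have h1 := (hg 0).tendsto_at hx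
    have h2 : Tendsto (fun i => (iteratedFDeriv ℝ 0 (f i) x).curry0) atTop
        (𝓝 ((g x 0).curry0)) :=
      ((continuousMultilinearCurryFin0 ℝ E F).continuous.tendsto _).comp h1
    exact tendsto_nhds_unique h2 (h₀ x hx)
  fderivWithin m _ x hx := by
    -- The derivative of `D^m` is `D^{m+1}` with one argument curried. Currying is an isometry, so
    -- uniform convergence is kept.
    let e := continuousMultilinearCurryLeftEquiv ℝ (fun _ : Fin (m + 1) => E) F
    have h1 : TendstoUniformlyOn (fun i y => e (iteratedFDeriv ℝ (m + 1) (f i) y))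
        (fun y => e (g y (m + 1))) atTop U :=
      e.isometry.uniformContinuous.comp_tendstoUniformlyOn (hg (m + 1))
    refine (hasFDerivAt_of_tendstoUniformlyOn (f := fun i => iteratedFDeriv ℝ m (f i)) hU h1
      (fun i y hy => ?_) (fun y hy => (hg m).tendsto_at hy) hx).hasFDerivWithinAt
    exact (((hf i).contDiffAt (hU.mem_nhds hy)).differentiableAt_iteratedFDeriv
      (by exact_mod_cast WithTop.coe_lt_top m)).hasFDerivAt
  cont m _ := by
    refine (hg m).continuousOn (Eventually.of_forall fun i => ?_).frequently
    refine ContinuousOn.congr ((hf i).continuousOn_iteratedFDerivWithin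
      (by exact_mod_cast le_top) hU.uniqueDiffOn) fun x hx => ?_
    exact (iteratedFDerivWithin_of_isOpen m hU hx).symm

/-- A uniformly Cauchy sequence of functions with values in a complete space converges
uniformly. -/
theorem UniformCauchySeqOn.exists_tendstoUniformlyOn {α β : Type*} [UniformSpace β]
    [CompleteSpace β] [Nonempty β] {f : ℕ → α → β} {s : Set α}
    (h : UniformCauchySeqOn f atTop s) : ∃ g : α → β, TendstoUniformlyOn f g atTop s := by
  have h1 : ∀ x, ∃ y, x ∈ s → Tendsto (fun i => f i x) atTop (𝓝 y) := fun x => by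
    by_cases hx : x ∈ s
    · obtain ⟨y, hy⟩ := cauchySeq_tendsto_of_complete (h.cauchySeq hx)
      exact ⟨y, fun _ => hy⟩
    · exact ⟨Classical.arbitrary β, fun h => absurd h hx⟩
  choose g hg using h1
  exact ⟨g, h.tendstoUniformlyOn_of_tendsto hg⟩

/-! ### Completeness of `C^∞(K)` and decay of coefficients -/

namespace SmoothSpaceOn

variable {p : ℕ} {K : Compacts (EuclideanSpace ℝ (Fin p))}

theorem iteratedFDeriv_sub (f g : SmoothSpaceOn K) (k : ℕ) {x : EuclideanSpace ℝ (Fin p)}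
    (hx : x ∈ interior (K : Set (EuclideanSpace ℝ (Fin p)))) :
    iteratedFDeriv ℝ k (f - g : SmoothSpaceOn K) x =
      iteratedFDeriv ℝ k f x - iteratedFDeriv ℝ k g x :=
  map_sub (iteratedFDerivCLM k hx) f g

/-- All derivatives converge uniformly on the interior, so their limits are the derivatives of the
limit function, and uniform continuity survives uniform limits. -/
theorem exists_tendsto_of_cauchy (hK : (K : Set (EuclideanSpace ℝ (Fin p))) =
    closure (interior (K : Set (EuclideanSpace ℝ (Fin p))))) (u : ℕ → SmoothSpaceOn K)
    (hu : ∀ n : ℕ, ∀ ε > 0, ∃ N, ∀ i ≥ N, ∀ j ≥ N, seminorms K n (u i - u j) < ε) :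
    ∃ f, Tendsto u atTop (𝓝 f) := by
  set U := interior (K : Set (EuclideanSpace ℝ (Fin p))) with hUdef
  have hU : IsOpen U := isOpen_interior
  have h1 (k : ℕ) : UniformCauchySeqOn (fun i => iteratedFDeriv ℝ k (u i)) atTop U := by
    rw [Metric.uniformCauchySeqOn_iff]
    intro ε hε
    obtain ⟨N, hN⟩ := hu k ε hε
    refine ⟨N, fun i hi j hj x hx => lt_of_le_of_lt ?_ (hN i hi j hj)⟩
    rw [dist_eq_norm, ← iteratedFDeriv_sub _ _ _ hx]
    exact norm_iteratedFDeriv_le _ le_rfl hx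
  -- Convergence on all of `K` is needed for the limit to be continuous up to the boundary.
  have h2 : UniformCauchySeqOn (fun i => (u i : EuclideanSpace ℝ (Fin p) → ℂ)) atTop K := by
    rw [Metric.uniformCauchySeqOn_iff]
    intro ε hε
    obtain ⟨N, hN⟩ := hu 0 ε hε
    refine ⟨N, fun i hi j hj x hx => lt_of_le_of_lt ?_ (hN i hi j hj)⟩
    rw [dist_eq_norm]
    exact norm_apply_le hK (u i - u j) hx
  choose g hg using fun k => (h1 k).exists_tendstoUniformlyOn
  obtain ⟨f₀, hf₀⟩ := h2.exists_tendstoUniformlyOn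
  let f₁ : EuclideanSpace ℝ (Fin p) → ℂ := (K : Set (EuclideanSpace ℝ (Fin p))).indicator f₀
  have hf₁ : TendstoUniformlyOn (fun i => (u i : EuclideanSpace ℝ (Fin p) → ℂ)) f₁ atTop K :=
    hf₀.congr_right fun x hx => (indicator_of_mem hx f₀).symm
  have ht := hasFTaylorSeriesUpToOn_of_tendstoUniformlyOn (g := fun x k => g k x) hU
    (fun i => (u i).2.2.2.1) hg (fun x hx => hf₁.tendsto_at (interior_subset hx))
  have hg' (k : ℕ) : TendstoUniformlyOn (fun i => iteratedFDeriv ℝ k (u i))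
      (iteratedFDeriv ℝ k f₁) atTop U :=
    (hg k).congr_right fun x hx =>
      (ht.eq_iteratedFDerivWithin_of_uniqueDiffOn (by exact_mod_cast le_top) hU.uniqueDiffOn
        hx).trans (iteratedFDerivWithin_of_isOpen k hU hx)
  obtain ⟨f, hf⟩ : ∃ f : SmoothSpaceOn K, f.1 = f₁ :=
    ⟨⟨f₁, fun x hx => indicator_of_notMem hx _,
      hf₁.continuousOn (Eventually.of_forall fun i => (u i).2.2.1).frequently, ht.contDiffOn,
      fun k => (hg' k).uniformContinuousOn
        (Eventually.of_forall fun i => (u i).2.2.2.2 k).frequently⟩, rfl⟩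
  refine ⟨f, ((withSeminorms K).tendsto_nhds _ _).2 fun n ε hε => ?_⟩
  have h3 : ∀ᶠ i in atTop, ∀ k ∈ Finset.range (n + 1), ∀ x ∈ U,
      dist (iteratedFDeriv ℝ k f₁ x) (iteratedFDeriv ℝ k (u i) x) < ε / 2 :=
    (Finset.eventually_all _).2 fun k _ => Metric.tendstoUniformlyOn_iff.1 (hg' k) _ (half_pos hε)
  filter_upwards [h3] with i hi
  refine lt_of_le_of_lt (supDeriv_le (half_pos hε).le fun k hk x hx => ?_) (half_lt_self hε)
  rw [iteratedFDeriv_sub _ _ _ hx, hf, ← dist_eq_norm, dist_comm]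
  exact (hi k (Finset.mem_range.2 (Nat.lt_succ_of_le hk)) x hx).le

/-- `C^∞(K)` is a Fréchet space, hence barrelled. -/
theorem barrelledSpace (hK : (K : Set (EuclideanSpace ℝ (Fin p))) =
    closure (interior (K : Set (EuclideanSpace ℝ (Fin p))))) :
    BarrelledSpace ℂ (SmoothSpaceOn K) := by
  let : UniformSpace (SmoothSpaceOn K) := IsTopologicalAddGroup.rightUniformSpace _
  have : IsUniformAddGroup (SmoothSpaceOn K) := isUniformAddGroup_of_addCommGroup
  have : (uniformity (SmoothSpaceOn K)).IsCountablyGenerated :=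
    IsUniformAddGroup.uniformity_countably_generated
  -- The topology comes from countably many seminorms, so Cauchy sequences suffice; barrelledness
  -- then follows from complete pseudometrizability, by Baire.
  have : CompleteSpace (SmoothSpaceOn K) := by
    refine UniformSpace.complete_of_cauchySeq_tendsto fun u hu =>
      exists_tendsto_of_cauchy hK u fun n ε hε => ?_
    have h1 : Tendsto (fun q : ℕ × ℕ => u q.1 - u q.2) (atTop ×ˢ atTop) (𝓝 0) :=
      ((IsUniformAddGroup.cauchy_map_iff_tendsto atTop u).1 hu).2
    have h2 := ((withSeminorms K).tendsto_nhds _ _).1 h1 n ε hε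
    rw [prod_atTop_atTop_eq] at h2
    obtain ⟨⟨N₁, N₂⟩, hN⟩ := eventually_atTop.1 h2
    refine ⟨max N₁ N₂, fun i hi j hj => ?_⟩
    simpa using hN (i, j) ⟨(le_max_left _ _).trans hi, (le_max_right _ _).trans hj⟩
  have : IsCompletelyPseudoMetrizableSpace (SmoothSpaceOn K) := inferInstance
  infer_instance

/-- If a series of exponentials converges unconditionally in `C^∞(K)`, and `K` has an interior
point, then its coefficients are rapidly decreasing. -/
theorem summable_of_summable_smoothExp {x : EuclideanSpace ℝ (Fin p)}
    (hx : x ∈ interior (K : Set (EuclideanSpace ℝ (Fin p)))) {ι : Type*} {c : ι → ℂ}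
    {l : ι → EuclideanSpace ℝ (Fin p)}
    (h : Summable fun j => c j • restrict K (smoothExp (l j))) (k : ℕ) :
    Summable fun j => ‖c j‖ * ‖l j‖ ^ k := by
  have h1 : Summable fun j => c j • iteratedFDeriv ℝ k (smoothExp (l j)) x := by
    refine (h.map (iteratedFDerivCLM k hx) (iteratedFDerivCLM k hx).continuous).congr fun j => ?_
    rw [Function.comp_apply, map_smul, iteratedFDerivCLM_apply, iteratedFDeriv_restrict _ _ hx]
  -- In finite dimension, unconditional convergence is absolute convergence.
  have : FiniteDimensional ℝ (EuclideanSpace ℝ (Fin p) [×k]→L[ℝ] ℂ) :=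
    FiniteDimensional.of_injective
      (ContinuousMultilinearMap.toMultilinearMapLinear (R' := ℝ) (A := ℝ))
      ContinuousMultilinearMap.toMultilinearMap_injective
  refine (h1.norm.mul_left (((2 * Real.pi) ^ k)⁻¹)).congr fun j => ?_
  rw [norm_smul, norm_iteratedFDeriv_smoothExp]
  have : (2 * Real.pi) ^ k ≠ 0 := by positivity
  field_simp

end SmoothSpaceOn

/-- The Banach-Steinhaus theorem: pointwise limits of continuous linear maps are continuous. -/
theorem exists_continuousLinearMap_of_tendsto {E F : Type*} [AddCommGroup E] [Module ℂ E]
    [TopologicalSpace E] [IsTopologicalAddGroup E] [ContinuousSMul ℂ E] [BarrelledSpace ℂ E]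
    [AddCommGroup F] [Module ℂ F] [TopologicalSpace F] [IsTopologicalAddGroup F]
    [ContinuousSMul ℂ F] [PolynormableSpace ℂ F] [T2Space F] (S : ℕ → E →L[ℂ] F) {g : E → F}
    (h : Tendsto (fun n x => S n x) atTop (𝓝 g)) : ∃ T : E →L[ℂ] F, ∀ x, T x = g x := by
  let : UniformSpace E := IsTopologicalAddGroup.rightUniformSpace _
  have : IsUniformAddGroup E := isUniformAddGroup_of_addCommGroup
  let : UniformSpace F := IsTopologicalAddGroup.rightUniformSpace _
  have : IsUniformAddGroup F := isUniformAddGroup_of_addCommGroup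
  exact ⟨continuousLinearMapOfTendsto S h, fun _ => rfl⟩

theorem exists_isExtensionOperator_of_hasSum {p : ℕ} {K : Compacts (EuclideanSpace ℝ (Fin p))}
    (hK : (K : Set (EuclideanSpace ℝ (Fin p))) =
      closure (interior (K : Set (EuclideanSpace ℝ (Fin p)))))
    (l : ℕ → EuclideanSpace ℝ (Fin p)) (u : ℕ → SmoothSpaceOn K →L[ℂ] ℂ)
    (h : ∀ f, HasSum (fun j => u j f • SmoothSpaceOn.restrict K (smoothExp (l j))) f) :
    ∃ T : SmoothSpaceOn K →L[ℂ] SmoothSpace p, IsExtensionOperator T := by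
  -- With empty interior `K` itself is empty, and any operator extends.
  rcases (interior (K : Set (EuclideanSpace ℝ (Fin p)))).eq_empty_or_nonempty with h0 | ⟨x₀, hx₀⟩
  · refine ⟨0, fun f x hx => ?_⟩
    have hx' : x ∈ (K : Set (EuclideanSpace ℝ (Fin p))) := hx
    rw [hK, h0, closure_empty] at hx'
    exact absurd hx' (notMem_empty x)
  have := SmoothSpaceOn.barrelledSpace hK
  choose g hg hgs using fun f : SmoothSpaceOn K =>
    SmoothSpace.exists_hasSum_smoothExp (fun j => u j f) l
      fun k => SmoothSpaceOn.summable_of_summable_smoothExp hx₀ (h f).summable k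
  let S (n : ℕ) : SmoothSpaceOn K →L[ℂ] SmoothSpace p :=
    ∑ j ∈ Finset.range n, (u j).smulRight (smoothExp (l j))
  have hS : Tendsto (fun n f => S n f) atTop (𝓝 g) := by
    refine tendsto_pi_nhds.2 fun f => ?_
    simpa [S] using (hgs f).tendsto_sum_nat
  obtain ⟨T, hT⟩ := exists_continuousLinearMap_of_tendsto S hS
  refine ⟨T, fun f x hx => ?_⟩
  rw [hT]
  have h1 : HasSum (fun j => u j f • SmoothSpaceOn.restrict K (smoothExp (l j)))
      (SmoothSpaceOn.restrict K (g f)) := by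
    simpa [Function.comp_def] using! (hgs f).map (SmoothSpaceOn.restrictCLM K)
      (SmoothSpaceOn.restrictCLM K).continuous
  -- Both sums belong to the same series; they are compared after evaluation at `x`, where
  -- uniqueness of sums in `ℂ` applies.
  have h2 := (h1.map (SmoothSpaceOn.evalCLM hK hx) (SmoothSpaceOn.evalCLM hK hx).continuous).unique
    ((h f).map (SmoothSpaceOn.evalCLM hK hx) (SmoothSpaceOn.evalCLM hK hx).continuous)
  rwa [SmoothSpaceOn.evalCLM_apply, SmoothSpaceOn.evalCLM_apply,
    SmoothSpaceOn.restrict_apply _ hx] at h2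

open MeasureTheory FourierTransform SchwartzMap

/-! ### Fourier series of functions supported in the unit cube -/

/-- The lattice point of `ℝ^p` with integer coordinates `m`. -/
noncomputable def intVec {p : ℕ} (m : Fin p → ℤ) : EuclideanSpace ℝ (Fin p) :=
  WithLp.toLp 2 fun i => (m i : ℝ)

theorem intVec_injective {p : ℕ} : Function.Injective (intVec (p := p)) := fun m n h => by
  funext i
  have := congrArg (fun v : EuclideanSpace ℝ (Fin p) => v i) h
  simpa [intVec] using this

theorem norm_intVec_ne_zero {p : ℕ} {m : Fin p → ℤ} (hm : m ≠ 0) : ‖intVec m‖ ≠ 0 := by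
  have h0 : intVec (0 : Fin p → ℤ) = 0 := by ext i; simp [intVec]
  rw [norm_ne_zero_iff, ← h0]
  exact intVec_injective.ne hm

/-- Over a lattice, inverse powers of the norm with exponent above the rank are summable. -/
theorem exists_summable_norm_intVec_inv_pow (p : ℕ) :
    ∃ n : ℕ, Summable fun m : Fin p → ℤ => ‖intVec m‖⁻¹ ^ n := by
  let b := (EuclideanSpace.basisFun (Fin p) ℝ).toBasis
  let L : Submodule ℤ (EuclideanSpace ℝ (Fin p)) := Submodule.span ℤ (range b)
  have hm (m : Fin p → ℤ) : intVec m ∈ L := by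
    refine (b.mem_span_iff_repr_mem ℤ _).2 fun i => ⟨m i, ?_⟩
    simp [b, intVec]
  exact ⟨_, (ZLattice.summable_norm_pow_inv L _ (Nat.lt_succ_self _)).comp_injective
    (i := fun m : Fin p → ℤ => (⟨intVec m, hm m⟩ : L)) fun m n h =>
      intVec_injective (congrArg Subtype.val h)⟩

/-- The values of a Schwartz function at the lattice points are rapidly decreasing. -/
theorem SchwartzMap.summable_intVec {p : ℕ} (h : 𝓢(EuclideanSpace ℝ (Fin p), ℂ)) (k : ℕ) :
    Summable fun m : Fin p → ℤ => ‖h (intVec m)‖ * ‖intVec m‖ ^ k := by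
  obtain ⟨n, hn⟩ := exists_summable_norm_intVec_inv_pow p
  -- The `n` extra powers of decay provide the summable majorant; it fails possibly at `m = 0`,
  -- hence the comparison outside a finite set.
  obtain ⟨C, -, hC⟩ := h.decay (k + n) 0
  refine Summable.of_norm_bounded_eventually (hn.mul_left C) ?_
  have h0 : ∀ᶠ m : Fin p → ℤ in cofinite, m ≠ 0 := by
    simp
  filter_upwards [h0] with m hm
  have h1 := hC (intVec m)
  rw [norm_iteratedFDeriv_zero, pow_add] at h1
  have h2 : 0 < ‖intVec m‖ := lt_of_le_of_ne (norm_nonneg _) (norm_intVec_ne_zero hm).symm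
  rw [Real.norm_of_nonneg (by positivity), inv_pow, ← div_eq_mul_inv, le_div_iff₀ (by positivity)]
  linarith

/-- The function on the torus which agrees with `h` on the unit cube around the origin. -/
noncomputable def torusLift {p : ℕ} (h : EuclideanSpace ℝ (Fin p) → ℂ) (t : UnitAddTorus (Fin p)) :
    ℂ :=
  h (WithLp.toLp 2 fun i => (AddCircle.equivIco (1 : ℝ) (-(1 / 2)) (t i) : ℝ))

section TorusLift

variable {p : ℕ} {h : EuclideanSpace ℝ (Fin p) → ℂ} (hs : ∀ y, 1 / 4 ≤ ‖y‖ → h y = 0)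

include hs

theorem torusLift_eq_zero {t : UnitAddTorus (Fin p)} {i : Fin p} (ht : 1 / 4 ≤ ‖t i‖) :
    torusLift h t = 0 := by
  refine hs _ (ht.trans ?_)
  set r : ℝ := (AddCircle.equivIco (1 : ℝ) (-(1 / 2)) (t i) : ℝ) with hr
  have h1 : (r : UnitAddCircle) = t i := AddCircle.coe_equivIco
  have h2 := (AddCircle.equivIco (1 : ℝ) (-(1 / 2)) (t i)).2
  have h3 : |r| ≤ |(1 : ℝ)| / 2 := by
    rw [abs_one, abs_le]
    constructor <;> linarith [h2.1, h2.2]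
  rw [← h1, (AddCircle.norm_coe_eq_abs_iff (1 : ℝ) one_ne_zero).2 h3]
  exact PiLp.norm_apply_le (WithLp.toLp 2 fun i =>
    (AddCircle.equivIco (1 : ℝ) (-(1 / 2)) (t i) : ℝ)) i

/-- The chosen representative of the class of `1 / 2` is `-1 / 2`, but `h` vanishes at both; if all
coordinates are below `1 / 4` in absolute value, the representative is `x` itself. -/
theorem torusLift_coe {x : Fin p → ℝ} (hx : ∀ i, |x i| ≤ 1 / 2) :
    torusLift h (fun i => (x i : UnitAddCircle)) = h (WithLp.toLp 2 x) := by
  by_cases h1 : ∃ i, 1 / 4 ≤ |x i|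
  · obtain ⟨i, hi⟩ := h1
    have h2 : ‖(x i : UnitAddCircle)‖ = |x i| :=
      (AddCircle.norm_coe_eq_abs_iff (1 : ℝ) one_ne_zero).2 (by simpa using hx i)
    rw [torusLift_eq_zero hs (i := i) (by rwa [h2]),
      hs _ (hi.trans (PiLp.norm_apply_le (WithLp.toLp 2 x) i))]
  · push Not at h1
    unfold torusLift
    congr 2
    funext i
    refine AddCircle.equivIco_coe_of_mem ⟨?_, ?_⟩ <;>
      linarith [(abs_lt.1 (h1 i)).1, (abs_lt.1 (h1 i)).2]

/-- The choice of representatives jumps only at the class of `1 / 2`. Near a point with a coordinate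
of norm above `1 / 4` the lift is zero; elsewhere every coordinate stays away from the jump. -/
theorem continuous_torusLift (hc : Continuous h) : Continuous (torusLift h) := by
  rw [continuous_iff_continuousAt]
  intro t
  by_cases h1 : ∃ i, 1 / 4 < ‖t i‖
  · obtain ⟨i, hi⟩ := h1
    have ho : IsOpen {s : UnitAddTorus (Fin p) | 1 / 4 < ‖s i‖} :=
      isOpen_lt continuous_const (continuous_apply i).norm
    refine (continuousAt_const (y := (0 : ℂ))).congr ?_
    filter_upwards [ho.mem_nhds hi] with s hs'
    exact (torusLift_eq_zero hs (le_of_lt hs')).symm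
  · push Not at h1
    refine hc.continuousAt.comp ((PiLp.continuous_toLp 2 _).continuousAt.comp
      (continuousAt_pi.2 fun i => ?_))
    refine continuous_subtype_val.continuousAt.comp
      (ContinuousAt.comp (f := fun s : UnitAddTorus (Fin p) => s i)
        (AddCircle.continuousAt_equivIco _ _ ?_) (continuous_apply i).continuousAt)
    intro h2
    have h3 := h1 i
    rw [h2, (AddCircle.norm_coe_eq_abs_iff (1 : ℝ) one_ne_zero).2
      (by norm_num [abs_of_neg])] at h3
    norm_num [abs_of_neg] at h3

end TorusLift

theorem mFourier_coe {p : ℕ} (m : Fin p → ℤ) (x : Fin p → ℝ) :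
    UnitAddTorus.mFourier m (fun i => (x i : UnitAddCircle)) =
      smoothExp (intVec m) (WithLp.toLp 2 x) := by
  simp only [UnitAddTorus.mFourier, ContinuousMap.coe_mk, fourier_coe_apply, smoothExp_apply]
  rw [← Complex.exp_sum]
  congr 1
  simp only [intVec, PiLp.inner_apply, RCLike.inner_apply, conj_trivial]
  push_cast
  rw [Finset.mul_sum]
  refine Finset.sum_congr rfl fun i _ => ?_
  ring

/-- The Fourier coefficients of a function on the torus as a Fourier transform. -/
theorem mFourierCoeff_torusLift {p : ℕ} {h : EuclideanSpace ℝ (Fin p) → ℂ}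
    (hs : ∀ y, 1 / 4 ≤ ‖y‖ → h y = 0) (m : Fin p → ℤ) :
    UnitAddTorus.mFourierCoeff (torusLift h) m = 𝓕 h (intVec m) := by
  have hB : MeasurableSet {x : Fin p → ℝ | ∀ i, x i ∈ Ioc (-(1 / 2) : ℝ) (-(1 / 2) + 1)} := by
    simpa [Set.pi, mem_ofPred_eq] using
      MeasurableSet.univ_pi fun i : Fin p =>
        measurableSet_Ioc (a := -(1 / 2 : ℝ)) (b := -(1 / 2) + 1)
  rw [UnitAddTorus.mFourierCoeff_eq_integral _ _ fun _ => -(1 / 2), Real.fourier_eq']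
  have h1 : ∀ x ∈ {x : Fin p → ℝ | ∀ i, x i ∈ Ioc (-(1 / 2) : ℝ) (-(1 / 2) + 1)},
      UnitAddTorus.mFourier (-m) (fun i => (x i : UnitAddCircle)) •
        torusLift h (fun i => (x i : UnitAddCircle)) =
      Complex.exp ((↑(-2 * Real.pi * inner ℝ (WithLp.toLp 2 x) (intVec m)) * Complex.I)) •
        h (WithLp.toLp 2 x) := by
    intro x hx
    rw [torusLift_coe hs fun i => abs_le.2 ⟨by linarith [(hx i).1], by linarith [(hx i).2]⟩,
      mFourier_coe, smoothExp_apply]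
    congr 2
    have : intVec (-m) = -intVec m := by ext i; simp [intVec]
    rw [this, inner_neg_right]
    push_cast
    ring
  -- As `h` vanishes off the cube, the coefficient integral over the cube is the Fourier integral
  -- over the whole space.
  rw [setIntegral_congr_fun hB h1, setIntegral_eq_integral_of_forall_compl_eq_zero]
  · exact (PiLp.volume_preserving_toLp (Fin p)).integral_comp
      (MeasurableEquiv.toLp 2 _).measurableEmbedding
      fun v => Complex.exp ((↑(-2 * Real.pi * inner ℝ v (intVec m)) * Complex.I)) • h v
  · intro x hx
    simp only [mem_ofPred_eq, not_forall] at hx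
    obtain ⟨i, hi⟩ := hx
    have h2 : 1 / 4 ≤ |x i| := by
      by_contra! h3
      exact hi ⟨by linarith [(abs_lt.1 h3).1], by linarith [(abs_lt.1 h3).2]⟩
    rw [hs _ (h2.trans (PiLp.norm_apply_le (WithLp.toLp 2 x) i)), smul_zero]

/-- A Schwartz function supported in a small ball is the sum of its Fourier series there. -/
theorem SchwartzMap.hasSum_fourier_intVec {p : ℕ} (h : 𝓢(EuclideanSpace ℝ (Fin p), ℂ))
    (hs : ∀ y, 1 / 4 ≤ ‖y‖ → h y = 0) {y : EuclideanSpace ℝ (Fin p)} (hy : ‖y‖ ≤ 1 / 2) :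
    HasSum (fun m : Fin p → ℤ => 𝓕 (h : EuclideanSpace ℝ (Fin p) → ℂ) (intVec m) *
      smoothExp (intVec m) y) (h y) := by
  let H : C(UnitAddTorus (Fin p), ℂ) := ⟨torusLift h, continuous_torusLift hs h.continuous⟩
  have hH (m : Fin p → ℤ) : UnitAddTorus.mFourierCoeff H m =
      𝓕 (h : EuclideanSpace ℝ (Fin p) → ℂ) (intVec m) := mFourierCoeff_torusLift hs m
  -- Absolutely summable coefficients make the Fourier series of a continuous function converge to
  -- it at every point.
  have h1 : Summable (UnitAddTorus.mFourierCoeff H) := by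
    refine Summable.of_norm ?_
    simp only [hH]
    exact ((𝓕 h).summable_intVec 0).congr fun m => by rw [pow_zero, mul_one, SchwartzMap.fourier_coe]
  have h2 := UnitAddTorus.hasSum_mFourier_series_apply_of_summable h1
    (fun i => (y i : UnitAddCircle))
  have h3 : H (fun i => (y i : UnitAddCircle)) = h y :=
    torusLift_coe hs fun i => (PiLp.norm_apply_le y i).trans hy
  rw [h3] at h2
  simpa only [hH, mFourier_coe, smul_eq_mul] using h2

/-! ### From extension operators to atomic decompositions -/

/-- A smooth bump function supported in the ball of radius `1 / 4`. -/
noncomputable def quarterBump (p : ℕ) : ContDiffBump (0 : EuclideanSpace ℝ (Fin p)) :=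
  -- The rescaled `K` will lie in the ball of radius `1 / 8`, where the bump is `1`.
  ⟨1 / 8, 1 / 4, by norm_num, by norm_num⟩

namespace SmoothSpace

variable {p : ℕ}

theorem quarterBump_eq_zero {y : EuclideanSpace ℝ (Fin p)} (hy : 1 / 4 ≤ ‖y‖) :
    quarterBump p y = 0 :=
  (quarterBump p).zero_of_le_dist (by simpa [quarterBump] using hy)

/-- The dilation of a smooth function by `c`, cut off outside the ball of radius `1 / 4`. -/
noncomputable def cutoff (c : ℝ) : SmoothSpace p →ₗ[ℂ] 𝓢(EuclideanSpace ℝ (Fin p), ℂ) where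
  toFun g := HasCompactSupport.toSchwartzMap (f := fun y => quarterBump p y • g (c • y))
    ((quarterBump p).hasCompactSupport.smul_right)
    ((quarterBump p).contDiff.smul (g.contDiff.comp (contDiff_const_smul c)))
  map_add' f g := by
    ext y
    exact smul_add (quarterBump p y) (f (c • y)) (g (c • y))
  map_smul' a g := by
    ext y
    exact smul_comm (quarterBump p y) a (g (c • y))

theorem cutoff_apply (c : ℝ) (g : SmoothSpace p) (y : EuclideanSpace ℝ (Fin p)) :
    cutoff c g y = quarterBump p y • g (c • y) := rfl

theorem cutoff_eq_zero (c : ℝ) (g : SmoothSpace p) (y : EuclideanSpace ℝ (Fin p))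
    (hy : 1 / 4 ≤ ‖y‖) : cutoff c g y = 0 := by
  rw [cutoff_apply, quarterBump_eq_zero hy, zero_smul]

/-- The exponential has modulus one and the bump confines `c • y` to a ball of radius `c`, so a
seminorm of order zero suffices. This makes the coefficient functionals continuous. -/
theorem norm_fourier_cutoff_le {c : ℝ} (hc : 0 ≤ c) (g : SmoothSpace p)
    (w : EuclideanSpace ℝ (Fin p)) :
    ‖𝓕 (cutoff c g) w‖ ≤ (∫ y, quarterBump p y) *
      seminorms p (⟨Metric.closedBall 0 c, isCompact_closedBall 0 c⟩, 0) g := by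
  rw [SchwartzMap.fourier_coe, Real.fourier_eq', ← integral_mul_const]
  refine norm_integral_le_of_norm_le ((quarterBump p).integrable.mul_const _)
    (Eventually.of_forall fun y => ?_)
  rw [norm_smul, Complex.norm_exp_ofReal_mul_I, one_mul, cutoff_apply, norm_smul,
    Real.norm_of_nonneg (quarterBump p).nonneg]
  rcases le_or_gt (1 / 4) ‖y‖ with hy | hy
  · simp [quarterBump_eq_zero hy]
  · refine mul_le_mul_of_nonneg_left (norm_apply_le g _ ?_) (quarterBump p).nonneg
    change c • y ∈ Metric.closedBall 0 c
    rw [mem_closedBall_zero_iff, norm_smul, Real.norm_of_nonneg hc]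
    nlinarith

/-- The Fourier transform at `w` of the dilated and cut off function, as a continuous linear
functional. -/
noncomputable def fourierCutoffCLM {c : ℝ} (hc : 0 ≤ c) (w : EuclideanSpace ℝ (Fin p)) :
    SmoothSpace p →L[ℂ] ℂ :=
  let A : SmoothSpace p →ₗ[ℂ] ℂ :=
    { toFun := fun g => 𝓕 (cutoff c g) w
      map_add' := fun f g => by rw [map_add, FourierTransform.fourier_add]; rfl
      map_smul' := fun a g => by rw [map_smul, FourierTransform.fourier_smul]; rfl }
  ⟨A, (withSeminorms p).continuous_normedSpace_rng ℂ A
    ⟨{(⟨Metric.closedBall 0 c, isCompact_closedBall 0 c⟩, 0)},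
      ⟨∫ y, quarterBump p y, integral_nonneg fun _ => (quarterBump p).nonneg⟩, fun g => by
        simp only [Finset.sup_singleton]
        exact norm_fourier_cutoff_le hc g w⟩⟩

theorem fourierCutoffCLM_apply {c : ℝ} (hc : 0 ≤ c) (w : EuclideanSpace ℝ (Fin p))
    (g : SmoothSpace p) : fourierCutoffCLM hc w g = 𝓕 (cutoff c g) w := rfl

end SmoothSpace

theorem smoothExp_smul {p : ℕ} (a : ℝ) (l x : EuclideanSpace ℝ (Fin p)) :
    smoothExp (a • l) x = smoothExp l (a • x) := by
  simp only [smoothExp_apply, inner_smul_left, inner_smul_right, conj_trivial]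

theorem exists_hasSum_of_isExtensionOperator {p : ℕ} {K : Compacts (EuclideanSpace ℝ (Fin p))}
    {T : SmoothSpaceOn K →L[ℂ] SmoothSpace p} (hT : IsExtensionOperator T) :
    ∃ (l : (Fin p → ℤ) → EuclideanSpace ℝ (Fin p)) (u : (Fin p → ℤ) → SmoothSpaceOn K →L[ℂ] ℂ),
      ∀ f, HasSum (fun m => u m f • SmoothSpaceOn.restrict K (smoothExp (l m))) f := by
  obtain ⟨R, hR⟩ := K.isCompact.isBounded.exists_norm_le
  -- The factor `8` puts `c⁻¹ • K` in the ball of radius `1 / 8`; the maximum with `1` keeps `c`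
  -- positive.
  let c : ℝ := 8 * max R 1
  have hc : 0 < c := by positivity
  have hcK : ∀ x ∈ K, ‖c⁻¹ • x‖ ≤ 1 / 8 := fun x hx => by
    have h1 := (hR x hx).trans (le_max_left R 1)
    rw [norm_smul, norm_inv, Real.norm_of_nonneg hc.le, inv_mul_le_iff₀ hc]
    change ‖x‖ ≤ 8 * max R 1 * (1 / 8)
    linarith
  refine ⟨fun m => c⁻¹ • intVec m,
    fun m => (SmoothSpace.fourierCutoffCLM hc.le (intVec m)).comp T, fun f => ?_⟩
  simp only [ContinuousLinearMap.comp_apply, SmoothSpace.fourierCutoffCLM_apply]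
  set h := SmoothSpace.cutoff c (T f) with hh
  have hs (k : ℕ) : Summable fun m : Fin p → ℤ => ‖𝓕 h (intVec m)‖ * ‖c⁻¹ • intVec m‖ ^ k := by
    refine (((𝓕 h).summable_intVec k).mul_left (‖c⁻¹‖ ^ k)).congr fun m => ?_
    rw [norm_smul, mul_pow]
    ring
  obtain ⟨g, hg, hgs⟩ := SmoothSpace.exists_hasSum_smoothExp (fun m => 𝓕 h (intVec m))
    (fun m => c⁻¹ • intVec m) hs
  -- At `c⁻¹ • x` with `x ∈ K` the bump is `1`, so the Fourier series there sums to `T f x = f x`;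
  -- the dilation is absorbed in the frequencies `c⁻¹ • m`.
  have hgf : SmoothSpaceOn.restrict K g = f := SmoothSpaceOn.ext fun x hx => by
    have h1 := h.hasSum_fourier_intVec (SmoothSpace.cutoff_eq_zero c (T f)) (y := c⁻¹ • x)
      ((hcK x hx).trans (by norm_num))
    have h2 : quarterBump p (c⁻¹ • x) = 1 :=
      (quarterBump p).one_of_mem_closedBall (by simpa [quarterBump] using! hcK x hx)
    rw [SmoothSpaceOn.restrict_apply _ hx, hg]
    simp only [smoothExp_smul, SchwartzMap.fourier_coe]
    rw [h1.tsum_eq, hh, SmoothSpace.cutoff_apply, h2, one_smul, smul_inv_smul₀ hc.ne']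
    exact hT f x hx
  rw [← hgf]
  simpa [Function.comp_def, SmoothSpaceOn.restrictCLM_apply] using!
    hgs.map (SmoothSpaceOn.restrictCLM K) (SmoothSpaceOn.restrictCLM K).continuous

/-- A series indexed by a countable type may be indexed by the natural numbers. -/
theorem exists_nat_hasSum_smul {ι X E : Type*} [Countable ι] [Inhabited X] [AddCommGroup E]
    [Module ℂ E] [TopologicalSpace E] (e : X → E) (l : ι → X) (u : ι → E →L[ℂ] ℂ)
    (h : ∀ y, HasSum (fun i => u i y • e (l i)) y) :
    ∃ (l' : ℕ → X) (u' : ℕ → E →L[ℂ] ℂ), ∀ y, HasSum (fun j => u' j y • e (l' j)) y := by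
  obtain ⟨φ, hφ⟩ := exists_injective_nat ι
  -- An injection into `ℕ` suffices, which also covers a finite index type (`p = 0`): outside its
  -- range the functional is `0` and the frequency is immaterial.
  refine ⟨Function.extend φ l default, Function.extend φ u 0, fun y => ?_⟩
  convert (hasSum_extend_zero hφ).2 (h y) using 1
  funext j
  by_cases hj : ∃ i, φ i = j
  · obtain ⟨i, rfl⟩ := hj
    simp [hφ.extend_apply]
  · simp [Function.extend_apply' _ _ _ hj]

theorem mainTheorem5 (p : ℕ) (K : TopologicalSpace.Compacts (EuclideanSpace ℝ (Fin p)))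
    (hK : (K : Set (EuclideanSpace ℝ (Fin p))) =
      closure (interior (K : Set (EuclideanSpace ℝ (Fin p))))) :
    (∃ T : SmoothSpaceOn K →L[ℂ] SmoothSpace p, IsExtensionOperator T) ↔
      ∃ (l : ℕ → EuclideanSpace ℝ (Fin p)) (u : ℕ → SmoothSpaceOn K →L[ℂ] ℂ),
        IsUnconditionalAtomicDecomposition u
          (fun j => SmoothSpaceOn.restrict K (smoothExp (l j))) := by
  constructor
  · rintro ⟨T, hT⟩
    obtain ⟨l, u, h⟩ := exists_hasSum_of_isExtensionOperator hT
    obtain ⟨l', u', h'⟩ := exists_nat_hasSum_smul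
      (fun l => SmoothSpaceOn.restrict K (smoothExp l)) l u h
    exact ⟨l', u', fun f => (h' f).tendsto_sum_nat, h'⟩
  · rintro ⟨l, u, -, h⟩
    exact exists_isExtensionOperator_of_hasSum hK l u h
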